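/- **Conventions.** Let $P$ be a poset; for $A\subseteq P$ let $\uparrow\! A$, $\downarrow\! A$ be its up- and down-closure. Directed sets are nonempty. A set $U\subseteq P$ is *Scott open* if it is an upper set and every directed $D\subseteq P$ whose supremum exists and lies in $U$ meets $U$; these sets form the Scott topology $\sigma(P)$, and $\Sigma P=(P,\sigma(P))$. The *Lawson topology* $\lambda(P)$ is generated by $\sigma(P)$ and the sets $P\setminus\uparrow\! x$ $(x\in P)$. An *ideal* is a directed lower set; $\mathrm{Id}(P)$ is the set of ideals, and an ideal is *principal* if it is $\downarrow\! x$ for some $x$. In a topological space, $\uparrow\! A$ is the intersection of all open sets containing $A$ (in $\Sigma P$ this is the up-closure in $P$), and $A$ is *saturated* if $A=\uparrow\! A$. * $P$ is a *$c$-poset* if it has only countably many (possibly none) non-principal ideals, and one can choose for each non-principal ideal $I$ a strictly increasing sequence $c_{I,1}<c_{I,2}<\cdots$ with $I=\downarrow\!\{c_{I,m}:m\in\mathbb N\}$ such that, with $H_I$ the set of all $c_{I,m}$ together with their supremum if it exists, $P\setminus\bigcup_I H_I=\bigcup_{n\in\mathbb N}T_n$ for some subsets $T_n$ of $P$ each of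 which, in the restricted order, has only principal ideals. * A topological space $X$ is a *$C$-space* if for every open $U$ and $x\in U$ there is a supercompact set $S$ with $x\in\mathrm{int}\uparrow\! S\subseteq\uparrow\! S\subseteq U$; $S$ is *supercompact* if every family of open sets covering $S$ has a member containing $S$. * $P$ is an *$\ell c_\omega$-poset* (resp. *$\ell f_\omega$-poset*) if there are subsets $K_0\subseteq K_1\subseteq\cdots$ of $P$ with union $P$, each closed under those suprema of its directed subsets that exist in $P$, such that each $\Sigma K_n$ ($K_n$ with the restricted order) is locally compact (resp. locally finite), and $U\subseteq P$ is Scott open in $P$ if and only if $U\cap K_n$ is Scott open in $K_n$ for all $n$. *Locally compact* means that each point has a neighbourhood base of compact sets; *locally finite* means that for every open $U$ and $x\in U$ there is a nonempty finite $F$ with $\uparrow\! F$ open and $x\in\uparrow\! F\subseteq U$. * $(P,\lambda(P))$ is *upper semicompact* if $\uparrow\! x$ is Lawson compact for every $x\in P$. * A $T_0$ space is *well-filtered* if, whenever the intersection of a nonempty filtered (under inclusion) family of nonempty compact saturated sets lies in an open set $U$, some member lies in $U$; it is *coherent* if the intersection of any two compact saturated sets is compact; it is *sober* if each irreducible closed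 set is the closure of a unique point. * $P$ has *property R* if, whenever $(F_i)_{i\in I}$ is a nonempty family of nonempty finite subsets of $P$ and $U\in\sigma(P)$ satisfies $\bigcap_{i\in I}\uparrow\! F_i\subseteq U$, there is a nonempty finite $I_0\subseteq I$ with $\bigcap_{i\in I_0}\uparrow\! F_i\subseteq U$. **Theorem 5.14.** Let $P$ be a poset satisfying one of: (i) $\mathrm{Id}(P)$ is countable; (ii) $P$ is a $c$-poset; (ii′) $\Sigma P$ is a $C$-space; (iii) $P$ is an $\ell f_\omega$-poset; (iv) $P$ is an $\ell c_\omega$-poset; (v) $\Sigma(P\times P)=\Sigma P\times\Sigma P$. Suppose that $P$ also satisfies one of: (a) $(P,\lambda(P))$ is compact; (b) $(P,\lambda(P))$ is upper semicompact; (c) $\Sigma P$ is well-filtered and coherent; (d) $P$ has property R. Then $\Sigma P$ is sober. Moreover, for every poset $P$, (i) $\Rightarrow$ (ii) $\Rightarrow$ (iii) $\Rightarrow$ (iv) $\Rightarrow$ (v) and (ii′) $\Rightarrow$ (iv), and (a) $\Rightarrow$ (b) $\Rightarrow$ (d) and (c) $\Rightarrow$ (d). -/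

import Mathlib

namespace DomainTheory

open Set Topology

/-! Throughout, `WithScott P` is the Scott space `ΣP`, and `nhdsKer A` is the intersection of all
open sets containing `A`, i.e. the up-closure of `A` in the specialization order
(`x ≤ y ↔ x ∈ closure {y}`); in `ΣP` it is the up-closure of `A` in the poset `P`. -/

section Spaces

variable (X : Type*) [TopologicalSpace X]

/-- Every irreducible closed set is the closure of a unique point. -/
def IsSober : Prop :=
  ∀ A : Set X, IsIrreducible A → IsClosed A → ∃! x : X, A = closure {x}

variable {X} in
/-- A set is saturated if it is the intersection of all open sets containing it. -/
def IsSaturated (A : Set X) : Prop := nhdsKer A = A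

/-- A `T₀` space such that, whenever a filtered family of nonempty compact saturated sets has its
intersection inside an open set, some member already lies inside that open set. -/
def IsWellFiltered : Prop :=
  T0Space X ∧ ∀ (𝒦 : Set (Set X)) (U : Set X), IsOpen U → 𝒦.Nonempty →
    (∀ K ∈ 𝒦, K.Nonempty ∧ IsCompact K ∧ IsSaturated K) →
    DirectedOn (fun K L => L ⊆ K) 𝒦 → ⋂₀ 𝒦 ⊆ U → ∃ K ∈ 𝒦, K ⊆ U

/-- The intersection of any two compact saturated sets is compact. -/
def IsCoherent : Prop :=
  ∀ K L : Set X, IsCompact K → IsSaturated K → IsCompact L → IsSaturated L → IsCompact (K ∩ L)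

variable {X} in
/-- Any family of open sets covering `S` has a member covering `S`. -/
def IsSupercompact (S : Set X) : Prop :=
  ∀ 𝒰 : Set (Set X), (∀ U ∈ 𝒰, IsOpen U) → S ⊆ ⋃₀ 𝒰 → ∃ U ∈ 𝒰, S ⊆ U

/-- `C`-spaces: each point has a neighbourhood base of up-closures of supercompact sets. -/
def IsCSpace : Prop :=
  ∀ (x : X) (U : Set X), IsOpen U → x ∈ U →
    ∃ S : Set X, IsSupercompact S ∧ x ∈ interior (nhdsKer S) ∧ nhdsKer S ⊆ U

/-- Each point has a neighbourhood base of open sets of the form `↑F` with `F` finite. -/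
def IsLocallyFiniteSpace : Prop :=
  ∀ (x : X) (U : Set X), IsOpen U → x ∈ U →
    ∃ F : Set X, F.Finite ∧ F.Nonempty ∧ IsOpen (nhdsKer F) ∧ x ∈ nhdsKer F ∧ nhdsKer F ⊆ U

/-- Property R: whenever the intersection of a nonempty family of sets `↑F`, with `F` finite and
nonempty, lies in an open set `U`, so does the intersection of some finite nonempty subfamily. -/
def HasPropertyR : Prop :=
  ∀ (ℱ : Set (Set X)) (U : Set X), ℱ.Nonempty → (∀ F ∈ ℱ, F.Finite ∧ F.Nonempty) → IsOpen U →
    ⋂ F ∈ ℱ, nhdsKer F ⊆ U →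
      ∃ 𝒢 : Set (Set X), 𝒢 ⊆ ℱ ∧ 𝒢.Finite ∧ 𝒢.Nonempty ∧ ⋂ F ∈ 𝒢, nhdsKer F ⊆ U

/-- A topological space with an order all of whose principal up-sets are compact. -/
def IsUpperSemicompact [Preorder X] : Prop := ∀ x : X, IsCompact (Ici x)

end Spaces

section Posets

variable (P : Type*) [PartialOrder P]

/-- `Σ(P × P) = ΣP × ΣP`: the Scott topology of `P × P` is the product of the Scott topologies. -/
def ScottProdEq : Prop :=
  scott (P × P) univ = @instTopologicalSpaceProd P P (scott P univ) (scott P univ)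

variable {P} in
/-- An increasing sequence of `d`-sub-posets (subsets closed under those suprema of their directed
subsets that exist in `P`) that covers `P` and determines the Scott topology of `P`. Each `K n`
carries the restricted order, and `Σ(K n)` its own Scott topology. -/
structure IsScottExhaustion (K : ℕ → Set P) : Prop where
  dirSupClosed : ∀ n, DirSupClosed (K n)
  mono : ∀ n m, n ≤ m → K n ⊆ K m
  iUnion_eq : ⋃ n, K n = univ
  isOpen_iff : ∀ U : Set P, IsOpen[scott P univ] U ↔
    ∀ n, IsOpen[scott (K n) univ] ((Subtype.val : K n → P) ⁻¹' U)

/-- `ℓc_ω`-posets. -/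
def IsLcOmegaPoset : Prop :=
  ∃ K : ℕ → Set P, IsScottExhaustion K ∧ ∀ n, LocallyCompactSpace (WithScott (K n))

/-- `ℓf_ω`-posets. -/
def IsLfOmegaPoset : Prop :=
  ∃ K : ℕ → Set P, IsScottExhaustion K ∧ ∀ n, IsLocallyFiniteSpace (WithScott (K n))

/-- The ideals that are not of the form `↓x`. -/
def nonprincipalIdeals : Set (Order.Ideal P) := {I | ∀ x : P, I ≠ Order.Ideal.principal x}

variable {P} in
/-- The range of a sequence, together with its supremum if that exists. -/
def rangeWithSup (c : ℕ → P) : Set P := range c ∪ {s | IsLUB (range c) s}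

/-- `c`-posets: there are countably (possibly only finitely) many non-principal ideals, each is
generated by a chosen strictly increasing sequence, and the points outside all these sequences and
their existing suprema form a countable union of subsets whose ideals are all principal. -/
def IsCPoset : Prop :=
  (nonprincipalIdeals P).Countable ∧
    ∃ c : nonprincipalIdeals P → ℕ → P,
      (∀ I, StrictMono (c I) ∧ ((I : Order.Ideal P) : Set P) = {x | ∃ m, x ≤ c I m}) ∧
      ∃ T : ℕ → Set P, (⋃ I, rangeWithSup (c I))ᶜ = ⋃ n, T n ∧
        ∀ n, nonprincipalIdeals (T n) = ∅

end Posets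

end DomainTheory

/-!
Sobriety follows from `Σ(P × P) = ΣP × ΣP` and property R. Let `A` be an irreducible Scott closed
set. By property R the set of pairs `(x, y)` that have no common upper bound in `A` is Scott open
in `P × P`; if it contained a pair of points of `A`, it would contain a box `V × V'` with `V` and
`V'` open and both meeting `A`, and irreducibility would give a point `z ∈ V ∩ V' ∩ A` with
`(z, z)` in it, which is absurd. Hence `A` is directed, and a second application of property R gives
an upper bound of `A` inside `A`, that is, a greatest element
(`isSober_of_scottProdEq_of_hasPropertyR`). All other hypotheses reduce to these two.

The equality `Σ(P × P) = ΣP × ΣP` holds for an `ℓc_ω`-poset because compact boxes inside a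
Scott open set can be enlarged step by step along the exhaustion by the tube lemma, the union
being an open box (`IsLcOmegaPoset.scottProdEq`). This uses that a directed supremum computed in a
member of the exhaustion is a supremum in `P` (`IsScottExhaustion.isLUB_image`) and that
`Σ(K × L) = ΣK × ΣL` when `ΣK` is locally compact (`isOpen_withScott_prod`).

A `c`-poset is an `ℓf_ω`-poset because finite unions of chains, finite sets and sets with only
principal ideals have only finitely many ideals that are generated by a directed subset without
greatest element (`IsNoetherianModulo`), which makes their Scott spaces locally finite. In the
exhaustion (`IsCPoset.isLfOmegaPoset`) the generating chain of a non-principal ideal is added as a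
whole if it has a supremum in `P`, and one point at a time otherwise.

Property R is a compactness statement for the sets `↑F`. For upper semicompact Lawson topologies it
is ordinary compactness of the Lawson closed sets `↑F`, and for well-filtered coherent spaces it is
well-filteredness applied to the finite intersections of these sets.
-/

namespace DomainTheory

open Set Topology

/-! ### The Scott topology in terms of the order -/

section ScottBasics

variable {P : Type*} [PartialOrder P]

lemma isOpen_scott_iff {U : Set P} :
    IsOpen[scott P univ] U ↔ IsUpperSet U ∧ DirSupInacc U := by
  rw [← dirSupInaccOn_univ]
  let := scott P univ
  have : IsScott P univ := ⟨rfl⟩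
  exact IsScott.isOpen_iff_isUpperSet_and_dirSupInaccOn

lemma isOpen_withScott_iff {U : Set (WithScott P)} :
    IsOpen U ↔ IsUpperSet (α := P) U ∧ DirSupInacc (α := P) U :=
  isOpen_scott_iff (P := P)

lemma closure_singleton_withScott (x : WithScott P) : closure {x} = Iic x := by
  let := scott P univ
  have : IsScott P univ := ⟨rfl⟩
  exact IsScott.closure_singleton (α := P)

lemma mem_nhdsKer_withScott_iff {A : Set (WithScott P)} {y : WithScott P} :
    y ∈ nhdsKer A ↔ ∃ x ∈ A, x ≤ y := by
  simp only [mem_nhdsKer_iff_specializes, specializes_iff_mem_closure, closure_singleton_withScott,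
    mem_Iic]

lemma nhdsKer_withScott_eq_biUnion (A : Set (WithScott P)) : nhdsKer A = ⋃ x ∈ A, Ici x := by
  ext y
  simp [mem_nhdsKer_withScott_iff]

end ScottBasics

/-! ### Conditions that imply property R -/

section PropertyR

variable {P : Type*} [PartialOrder P]

lemma isClosed_Ici_withLawson (x : WithLawson P) : IsClosed (Ici x) :=
  lawsonClosed_of_lowerClosed (α := P) (Ici (WithLawson.ofLawson x))
    (isClosed_Ici (α := WithLower P) (a := WithLower.toLower (WithLawson.ofLawson x)))

lemma isUpperSemicompact_of_compactSpace [CompactSpace (WithLawson P)] :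
    IsUpperSemicompact (WithLawson P) :=
  fun x => (isClosed_Ici_withLawson x).isCompact

lemma hasPropertyR_of_isUpperSemicompact (h : IsUpperSemicompact (WithLawson P)) :
    HasPropertyR (WithScott P) := by
  rintro ℱ U ⟨F₀, hF₀⟩ hℱ hU hsub
  let up : Set P → Set (WithLawson P) := fun F => ⋃ x ∈ F, Ici x
  have hup : ∀ F : Set P, up F = nhdsKer (X := WithScott P) F := fun F =>
    (nhdsKer_withScott_eq_biUnion _).symm
  have hclosed : ∀ F ∈ ℱ, IsClosed (up F) := fun F hF =>
    (hℱ F hF).1.isClosed_biUnion fun x _ => isClosed_Ici_withLawson x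
  have hcompact : IsCompact (up F₀) := (hℱ F₀ hF₀).1.isCompact_biUnion fun x _ => h x
  have hUL : IsOpen (X := WithLawson P) U := lawson_le_scott (α := P) _ hU
  obtain ⟨t, ht⟩ := (hcompact.inter_right hUL.isClosed_compl).elim_finite_subfamily_closed
    (fun F : ℱ => up F.1) (fun F => hclosed F F.2) (by
      rw [eq_empty_iff_forall_notMem]
      rintro x ⟨⟨_, hxU⟩, hx⟩
      refine hxU (hsub ?_)
      exact mem_iInter₂.2 fun F hF => (hup F).subset (mem_iInter.1 hx ⟨F, hF⟩))
  refine ⟨insert F₀ (Subtype.val '' (t : Set ℱ)), ?_, (t.finite_toSet.image _).insert _,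
    insert_nonempty _ _, fun x hx => ?_⟩
  · rw [insert_subset_iff]
    exact ⟨hF₀, by rintro _ ⟨F, _, rfl⟩; exact F.2⟩
  · by_contra hxU
    refine (eq_empty_iff_forall_notMem.1 ht) x ⟨⟨?_, hxU⟩, ?_⟩
    · exact (hup F₀).superset (mem_iInter₂.1 hx F₀ (mem_insert _ _))
    · refine mem_iInter₂.2 fun F hF => (hup F.1).superset ?_
      exact mem_iInter₂.1 hx F.1 (mem_insert_of_mem _ ⟨F, hF, rfl⟩)

variable {X : Type*} [TopologicalSpace X]

lemma IsSaturated.biInter {ι : Type*} {s : Set ι} {A : ι → Set X}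
    (h : ∀ i ∈ s, IsSaturated (A i)) : IsSaturated (⋂ i ∈ s, A i) := by
  refine subset_antisymm (subset_iInter₂ fun i hi => ?_) subset_nhdsKer
  exact (nhdsKer_mono (biInter_subset_of_mem hi)).trans (h i hi).subset

lemma isSaturated_nhdsKer (A : Set X) : IsSaturated (nhdsKer A) := nhdsKer_nhdsKer A

lemma IsCoherent.isCompact_biInter (h : IsCoherent X) {ι : Type*} {s : Set ι} (hs : s.Finite)
    (hne : s.Nonempty) {A : ι → Set X} (hc : ∀ i ∈ s, IsCompact (A i))
    (hA : ∀ i ∈ s, IsSaturated (A i)) : IsCompact (⋂ i ∈ s, A i) := by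
  induction s, hs using Set.Finite.induction_on with
  | empty => exact absurd hne not_nonempty_empty
  | @insert i s _ _ ih =>
    rw [forall_mem_insert] at hc hA
    rcases s.eq_empty_or_nonempty with rfl | hs
    · simpa using hc.1
    · rw [biInter_insert]
      exact h _ _ hc.1 hA.1 (ih hs hc.2 hA.2) (IsSaturated.biInter hA.2)

lemma hasPropertyR_of_isWellFiltered_of_isCoherent (hw : IsWellFiltered X) (hc : IsCoherent X) :
    HasPropertyR X := by
  intro ℱ U hne hℱ hU hsub
  by_contra! hcon
  -- If no finite intersection lies in `U`, all of them are nonempty, and well-filteredness applies.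
  let 𝒦 : Set (Set X) := {K | ∃ 𝒢 ⊆ ℱ, 𝒢.Finite ∧ 𝒢.Nonempty ∧ K = ⋂ F ∈ 𝒢, nhdsKer F}
  obtain ⟨F₀, hF₀⟩ := hne
  obtain ⟨_, ⟨𝒢, h𝒢, hfin, hne, rfl⟩, hKU⟩ := hw.2 𝒦 U hU
    ⟨_, {F₀}, by simpa using hF₀, finite_singleton _, singleton_nonempty _, rfl⟩ (by
      rintro _ ⟨𝒢, h𝒢, hfin, hne, rfl⟩
      refine ⟨?_, hc.isCompact_biInter hfin hne
        (fun F hF => IsCompact.nhdsKer_iff.2 (hℱ F (h𝒢 hF)).1.isCompact)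
        (fun F _ => isSaturated_nhdsKer F), IsSaturated.biInter fun F _ => isSaturated_nhdsKer F⟩
      by_contra hemp
      rw [not_nonempty_iff_eq_empty] at hemp
      exact hcon 𝒢 h𝒢 hfin hne (hemp ▸ empty_subset U)) (by
      rintro _ ⟨𝒢₁, h₁, hfin₁, hne₁, rfl⟩ _ ⟨𝒢₂, h₂, hfin₂, hne₂, rfl⟩
      exact ⟨_, ⟨𝒢₁ ∪ 𝒢₂, union_subset h₁ h₂, hfin₁.union hfin₂, hne₁.inl, rfl⟩,
        biInter_subset_biInter_left subset_union_left,
        biInter_subset_biInter_left subset_union_right⟩) (by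
      refine fun x hx => hsub (mem_iInter₂.2 fun F hF => ?_)
      simpa using hx _ ⟨{F}, by simpa using hF, finite_singleton _, singleton_nonempty _, rfl⟩)
  exact hcon 𝒢 h𝒢 hfin hne hKU

end PropertyR

/-! ### Sobriety -/

section Sobriety

variable {P : Type*} [PartialOrder P]

/-- Property R for singletons `{x}`, in terms of the order. -/
lemma HasPropertyR.exists_finite_subset (hR : HasPropertyR (WithScott P)) {S U : Set P}
    (hS : S.Nonempty) (hU : IsOpen[scott P univ] U) (hSU : upperBounds S ⊆ U) :
    ∃ t ⊆ S, t.Finite ∧ t.Nonempty ∧ upperBounds t ⊆ U := by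
  let f : WithScott P → Set (WithScott P) := fun x => {x}
  have key : ∀ 𝒢 : Set (Set (WithScott P)), 𝒢 ⊆ f '' S →
      ⋂ F ∈ 𝒢, nhdsKer F = upperBounds (f ⁻¹' 𝒢) := by
    refine fun 𝒢 h𝒢 => subset_antisymm (fun y hy x hx => ?_)
      fun y hy => mem_iInter₂.2 fun F hF => ?_
    · obtain ⟨z, rfl, hz⟩ := mem_nhdsKer_withScott_iff.1 (mem_iInter₂.1 hy _ hx)
      exact hz
    · obtain ⟨x, _, rfl⟩ := h𝒢 hF
      exact mem_nhdsKer_withScott_iff.2 ⟨x, rfl, hy hF⟩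
  obtain ⟨𝒢, h𝒢, hfin, hne, hsub⟩ := hR (f '' S) U (hS.image f) (by
    rintro _ ⟨x, _, rfl⟩
    exact ⟨finite_singleton _, singleton_nonempty _⟩) hU (by
    rw [key _ subset_rfl]
    exact (congrArg upperBounds (preimage_image_eq (f := f) S singleton_injective)).subset.trans
      hSU)
  refine ⟨f ⁻¹' 𝒢, fun x hx => ?_, hfin.preimage singleton_injective.injOn, ?_,
    (key 𝒢 h𝒢) ▸ hsub⟩
  · obtain ⟨y, hy, hyx⟩ := h𝒢 hx
    exact singleton_injective hyx ▸ hy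
  · obtain ⟨F, hF⟩ := hne
    obtain ⟨x, _, rfl⟩ := h𝒢 hF
    exact ⟨x, hF⟩

/-- In a directed set, finitely many upward inherited conditions that can each be met by some
element can be met simultaneously. -/
lemma exists_forall_of_directedOn {α ι : Type*} [Preorder α] {D : Set α} (hne : D.Nonempty)
    (hD : DirectedOn (· ≤ ·) D) {p : ι → α → Prop} (hp : ∀ i a b, a ≤ b → p i a → p i b)
    {t : Set ι} (ht : t.Finite) (h : ∀ i ∈ t, ∃ a ∈ D, p i a) : ∃ a ∈ D, ∀ i ∈ t, p i a := by
  induction t, ht using Set.Finite.induction_on with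
  | empty => exact ⟨hne.some, hne.some_mem, by simp⟩
  | @insert i s _ _ ih =>
    rw [forall_mem_insert] at h
    obtain ⟨⟨a, haD, ha⟩, hs⟩ := h
    obtain ⟨b, hbD, hb⟩ := ih hs
    obtain ⟨c, hcD, hac, hbc⟩ := hD a haD b hbD
    exact ⟨c, hcD, forall_mem_insert.2 ⟨hp i a c hac ha, fun j hj => hp j b c hbc (hb j hj)⟩⟩

/-- Under property R, the pairs without a common upper bound in a given Scott closed set form a
Scott open subset of `P × P`. -/
lemma HasPropertyR.isOpen_pairs (hR : HasPropertyR (WithScott P)) {U : Set P}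
    (hU : IsOpen[scott P univ] U) :
    IsOpen[scott (P × P) univ] {p : P × P | Ici p.1 ∩ Ici p.2 ⊆ U} := by
  refine isOpen_scott_iff.2 ⟨fun p q hpq hp z hz =>
    hp ⟨hpq.1.trans hz.1, hpq.2.trans hz.2⟩, ?_⟩
  intro D hne hD p hp hpU
  obtain ⟨t, ht, hfin, -, htU⟩ := hR.exists_finite_subset
    (S := Prod.fst '' D ∪ Prod.snd '' D) (hne.image _).inl hU (by
      refine fun z hz => hpU ?_
      have : p ≤ (z, z) := hp.2 fun q hq =>
        ⟨hz (Or.inl (mem_image_of_mem _ hq)), hz (Or.inr (mem_image_of_mem _ hq))⟩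
      exact ⟨this.1, this.2⟩)
  -- Directedness of `D` provides one pair that dominates the finite set `t`.
  obtain ⟨d, hdD, hd⟩ := exists_forall_of_directedOn hne hD
    (p := fun x d => x ≤ d.1 ∨ x ≤ d.2)
    (fun _ _ _ hde => Or.imp (·.trans hde.1) (·.trans hde.2)) hfin (by
      intro x hx
      rcases ht hx with ⟨e, he, rfl⟩ | ⟨e, he, rfl⟩
      exacts [⟨e, he, Or.inl le_rfl⟩, ⟨e, he, Or.inr le_rfl⟩])
  exact ⟨d, hdD, fun z hz => htU fun x hx => (hd x hx).elim (·.trans hz.1) (·.trans hz.2)⟩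

theorem isSober_of_scottProdEq_of_hasPropertyR (hP : ScottProdEq P)
    (hR : HasPropertyR (WithScott P)) : IsSober (WithScott P) := by
  intro A hA hAc
  let B : Set P := A
  have hBo : IsOpen[scott P univ] Bᶜ := hAc.isOpen_compl
  have hlow : IsLowerSet B := isUpperSet_compl.1 (isOpen_scott_iff.1 hBo).1
  have hdir : DirectedOn (· ≤ ·) B := by
    intro x hx y hy
    by_contra! hcon
    have hW := hR.isOpen_pairs hBo
    rw [show scott (P × P) univ = _ from hP] at hW
    have hxy : (x, y) ∈ {p : P × P | Ici p.1 ∩ Ici p.2 ⊆ Bᶜ} :=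
      fun z hz hzB => hcon z hzB hz.1 hz.2
    obtain ⟨V, V', hV, hV', hxV, hyV', hsub⟩ :=
      (@isOpen_prod_iff P P (scott P univ) (scott P univ) _).1 hW x y hxy
    obtain ⟨z, hzA, hzV, hzV'⟩ := hA.isPreirreducible V V' hV hV' ⟨x, hx, hxV⟩ ⟨y, hy, hyV'⟩
    exact (hsub (mk_mem_prod hzV hzV')) ⟨le_refl (α := P) z, le_refl (α := P) z⟩ hzA
  obtain ⟨m, hmB, hm⟩ : ∃ m ∈ B, ∀ x ∈ B, x ≤ m := by
    by_contra! hcon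
    obtain ⟨t, htB, hfin, htne, ht⟩ := hR.exists_finite_subset hA.nonempty hBo
      fun m hm hmB => let ⟨x, hx, hxm⟩ := hcon m hmB; hxm (hm hx)
    obtain ⟨z, hzB, hz⟩ := exists_forall_of_directedOn hA.nonempty hdir (p := (· ≤ ·))
      (fun _ _ _ hab hxa => hxa.trans hab) hfin fun x hx => ⟨x, htB hx, le_rfl⟩
    exact ht (fun x hx => hz x hx) hzB
  refine ⟨m, ?_, fun y hy => ?_⟩
  · refine Eq.trans ?_ (closure_singleton_withScott (P := P) m).symm
    exact subset_antisymm hm fun x hx => hlow hx hmB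
  · simp only [closure_singleton_withScott] at hy
    have h1 : y ∈ A := hy ▸ (le_refl (α := P) y)
    have h2 : m ∈ Iic y := hy ▸ hmB
    exact le_antisymm (α := P) (hm y h1) h2

end Sobriety

/-! ### Products of Scott spaces -/

section Products

variable {P K L : Type*} [PartialOrder P] [PartialOrder K] [PartialOrder L]

/-- Every open set of `ΣK × ΣL` is Scott open in `K × L`. -/
lemma isOpen_scott_prod {W : Set (K × L)} (hW : IsOpen (X := WithScott K × WithScott L) W) :
    IsOpen[scott (K × L) univ] W := by
  replace hW := (isOpen_prod_iff (X := WithScott K) (Y := WithScott L)).1 hW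
  refine isOpen_scott_iff.2 ⟨fun p q hpq hp => ?_, fun D hne hD p hp hpW => ?_⟩
  · obtain ⟨V, V', hV, hV', h1, h2, hsub⟩ := hW p.1 p.2 hp
    exact hsub ⟨(isOpen_withScott_iff.1 hV).1 hpq.1 h1, (isOpen_withScott_iff.1 hV').1 hpq.2 h2⟩
  · obtain ⟨V, V', hV, hV', h1, h2, hsub⟩ := hW p.1 p.2 hpW
    replace hV := isOpen_withScott_iff.1 hV
    replace hV' := isOpen_withScott_iff.1 hV'
    rw [isLUB_prod] at hp
    obtain ⟨_, ⟨d, hd, rfl⟩, hdV⟩ := hV.2 (hne.image Prod.fst)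
      (hD.mono_comp (fun _ _ h => h.1)) hp.1 h1
    obtain ⟨_, ⟨e, he, rfl⟩, heV⟩ := hV'.2 (hne.image Prod.snd)
      (hD.mono_comp (fun _ _ h => h.2)) hp.2 h2
    obtain ⟨f, hf, hdf, hef⟩ := hD d hd e he
    exact ⟨f, hf, hsub ⟨hV.1 hdf.1 hdV, hV'.1 hef.2 heV⟩⟩

/-- If `ΣK` is locally compact, every Scott open subset of `K × L` is open in `ΣK × ΣL`. -/
lemma isOpen_withScott_prod [LocallyCompactSpace (WithScott K)] {W : Set (K × L)}
    (hW : IsOpen[scott (K × L) univ] W) : IsOpen (X := WithScott K × WithScott L) W := by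
  have hWu := (isOpen_scott_iff.1 hW).1
  have hWd := (isOpen_scott_iff.1 hW).2
  -- The slices of `W` are Scott open.
  have hslice : ∀ b : L, IsOpen (X := WithScott K) {x | (x, b) ∈ W} := by
    refine fun b => isOpen_withScott_iff.2
      ⟨fun x y hxy hx => hWu (Prod.mk_le_mk.2 ⟨hxy, le_rfl⟩) hx, fun D hne hD a ha haW => ?_⟩
    obtain ⟨_, ⟨x, hx, rfl⟩, hxW⟩ := hWd (hne.image fun x => (x, b))
      (hD.mono_comp (fun _ _ h => ⟨h, le_rfl⟩)) (a := (a, b))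
      (isLUB_prod.2 ⟨by simpa [image_image] using ha,
        by simp [image_image, hne.image_const]⟩) haW
    exact ⟨x, hx, hxW⟩
  refine (isOpen_prod_iff (X := WithScott K) (Y := WithScott L)).2 fun a b hab => ?_
  obtain ⟨Q, hQa, hQW, hQ⟩ := local_compact_nhds (X := WithScott K) ((hslice b).mem_nhds hab)
  refine ⟨interior Q, {y : L | ∀ x ∈ Q, ((x, y) : K × L) ∈ W}, isOpen_interior, ?_,
    mem_interior_iff_mem_nhds.2 hQa, hQW, fun p hp => hp.2 p.1 (interior_subset hp.1)⟩
  refine isOpen_withScott_iff.2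
    ⟨fun x y hxy hx z hz => hWu (Prod.mk_le_mk.2 ⟨le_rfl, hxy⟩) (hx z hz),
      fun D hne hD d hd hdW => ?_⟩
  -- The slices at the points of `D` form a directed open cover of the compact set `Q`.
  have : Nonempty D := hne.to_subtype
  obtain ⟨y, hy⟩ := hQ.elim_directed_cover (fun y : D => {x : WithScott K | ((x, y) : K × L) ∈ W})
    (fun y => hslice y) (by
      intro (x : K) hx
      obtain ⟨_, ⟨y, hy, rfl⟩, hyW⟩ := hWd (hne.image fun y => ((x, y) : K × L))
        (hD.mono_comp (fun _ _ h => ⟨le_rfl, h⟩)) (a := ((x, d) : K × L))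
        (isLUB_prod.2 ⟨by
          rw [image_image, hne.image_const]
          exact isLUB_singleton, by simpa [image_image] using hd⟩) (hdW x hx)
      exact mem_iUnion.2 ⟨⟨y, hy⟩, hyW⟩) (by
      intro y z
      obtain ⟨w, hw, hyw, hzw⟩ := hD y y.2 z z.2
      exact ⟨⟨w, hw⟩, fun x hx => hWu (Prod.mk_le_mk.2 ⟨le_rfl, hyw⟩) hx,
        fun x hx => hWu (Prod.mk_le_mk.2 ⟨le_rfl, hzw⟩) hx⟩)
  exact ⟨y, y.2, hy⟩

/-- Tube lemma for Scott open sets of `K × L` when `ΣK` and `ΣL` are locally compact. -/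
lemma exists_compact_nhds_prod_subset [LocallyCompactSpace (WithScott K)]
    [LocallyCompactSpace (WithScott L)] {W : Set (K × L)} (hW : IsOpen[scott (K × L) univ] W)
    {A : Set (WithScott K)} {B : Set (WithScott L)} (hA : IsCompact A) (hB : IsCompact B)
    (hAB : A ×ˢ B ⊆ W) :
    ∃ (A' : Set (WithScott K)) (B' : Set (WithScott L)), IsCompact A' ∧ IsCompact B' ∧
      A ⊆ interior A' ∧ B ⊆ interior B' ∧ A' ×ˢ B' ⊆ W := by
  obtain ⟨U, V, hU, hV, hAU, hBV, hUV⟩ :=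
    generalized_tube_lemma hA hB (isOpen_withScott_prod (K := K) (L := L) hW) hAB
  obtain ⟨A', hA', hAA', hA'U⟩ := exists_compact_between hA hU hAU
  obtain ⟨B', hB', hBB', hB'V⟩ := exists_compact_between hB hV hBV
  exact ⟨A', B', hA', hB', hAA', hBB', (prod_mono hA'U hB'V).trans hUV⟩

end Products

/-! ### Exhaustions with locally compact members -/

section Exhaustions

variable {P : Type*} [PartialOrder P] {K : ℕ → Set P}

namespace IsScottExhaustion

/-- Directed suprema in a member of an exhaustion are suprema in the whole poset: the complements
of the sets `↓t` are Scott open in `P`, hence their traces on `K n` are Scott open in `K n`. -/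
lemma isLUB_image (h : IsScottExhaustion K) {n : ℕ} {D : Set (K n)} (hne : D.Nonempty)
    (hD : DirectedOn (· ≤ ·) D) {s : K n} (hs : IsLUB D s) :
    IsLUB (Subtype.val '' D) (s : P) := by
  refine ⟨by rintro _ ⟨d, hd, rfl⟩; exact hs.1 hd, fun t ht => ?_⟩
  by_contra hst
  have hopen : IsOpen[scott P univ] (Iic t)ᶜ :=
    isOpen_scott_iff.2 ⟨(isLowerSet_Iic t).compl, (dirSupClosed_Iic t).compl⟩
  obtain ⟨d, hdD, hd⟩ := (isOpen_scott_iff.1 ((h.isOpen_iff _).1 hopen n)).2 hne hD hs hst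
  exact hd (ht (mem_image_of_mem _ hdD))

lemma isLUB_inclusion (h : IsScottExhaustion K) {n m : ℕ} (hnm : n ≤ m) {D : Set (K n)}
    (hne : D.Nonempty) (hD : DirectedOn (· ≤ ·) D) {s : K n} (hs : IsLUB D s) :
    IsLUB (inclusion (h.mono n m hnm) '' D) (inclusion (h.mono n m hnm) s) := by
  have hP := h.isLUB_image hne hD hs
  refine ⟨by rintro _ ⟨d, hd, rfl⟩; exact hs.1 hd, fun t ht => hP.2 ?_⟩
  rintro _ ⟨d, hd, rfl⟩
  exact ht (mem_image_of_mem _ hd)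

lemma continuous_inclusion (h : IsScottExhaustion K) {n m : ℕ} (hnm : n ≤ m) :
    Continuous (X := WithScott (K n)) (Y := WithScott (K m)) (inclusion (h.mono n m hnm)) := by
  refine continuous_def.2 fun U hU => ?_
  rw [isOpen_withScott_iff] at hU ⊢
  refine ⟨fun x y hxy hx => hU.1 (show inclusion _ x ≤ inclusion _ y from hxy) hx,
    fun D hne hD s hs hsU => ?_⟩
  obtain ⟨_, ⟨d, hd, rfl⟩, hdU⟩ := hU.2 (hne.image _) (hD.mono_comp fun _ _ h => h)
    (h.isLUB_inclusion hnm hne hD hs) hsU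
  exact ⟨d, hd, hdU⟩

lemma isOpen_prod_preimage (h : IsScottExhaustion K) {W : Set (P × P)}
    (hW : IsOpen[scott (P × P) univ] W) (n : ℕ) :
    IsOpen[scott (K n × K n) univ] {p | ((p.1 : P), (p.2 : P)) ∈ W} := by
  rw [isOpen_scott_iff] at hW ⊢
  refine ⟨fun p q hpq hp => hW.1 (Prod.mk_le_mk.2 ⟨hpq.1, hpq.2⟩) hp,
    fun D hne hD s hs hsW => ?_⟩
  rw [isLUB_prod] at hs
  have h1 := h.isLUB_image (hne.image _) (hD.mono_comp (fun _ _ h => h.1)) hs.1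
  have h2 := h.isLUB_image (hne.image _) (hD.mono_comp (fun _ _ h => h.2)) hs.2
  rw [image_image] at h1 h2
  obtain ⟨_, ⟨d, hd, rfl⟩, hdW⟩ := hW.2 (hne.image fun p : K n × K n => ((p.1 : P), (p.2 : P)))
    (hD.mono_comp (fun _ _ h => h)) (isLUB_prod.2 (by simpa only [image_image] using ⟨h1, h2⟩)) hsW
  exact ⟨d, hd, hdW⟩

end IsScottExhaustion

/-- `A` is a subset of `K` that is compact in `ΣK`. -/
def IsCompactIn (K A : Set P) : Prop :=
  A ⊆ K ∧ IsCompact (X := WithScott K) ((Subtype.val : K → P) ⁻¹' A)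

/-- The trace of `B` on `K` is a neighbourhood of the trace of `A` in `ΣK`. -/
def IsNhdIn (K A B : Set P) : Prop :=
  ∃ O : Set K, IsOpen[scott K univ] O ∧ (Subtype.val : K → P) ⁻¹' A ⊆ O ∧
    O ⊆ (Subtype.val : K → P) ⁻¹' B

namespace IsScottExhaustion

lemma isCompactIn_mono (h : IsScottExhaustion K) {n m : ℕ} (hnm : n ≤ m) {A : Set P}
    (hA : IsCompactIn (K n) A) : IsCompactIn (K m) A := by
  refine ⟨hA.1.trans (h.mono n m hnm), ?_⟩
  have := hA.2.image (h.continuous_inclusion hnm)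
  convert this using 1
  ext x
  constructor
  · exact fun hx => ⟨⟨x.1, hA.1 hx⟩, hx, rfl⟩
  · rintro ⟨y, hy, rfl⟩
    exact hy

/-- A sequence in which each set is a neighbourhood of its predecessor is increasing. -/
lemma monotone_of_isNhdIn (h : IsScottExhaustion K) {n₀ : ℕ} {Q : ℕ → Set P}
    (hQK : ∀ k, Q k ⊆ K (n₀ + k)) (hQ : ∀ k, IsNhdIn (K (n₀ + (k + 1))) (Q k) (Q (k + 1))) :
    Monotone Q := by
  refine monotone_nat_of_le_succ fun k x hx => ?_
  obtain ⟨O, -, hQO, hOQ⟩ := hQ k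
  exact @hOQ ⟨x, h.mono (n₀ + k) (n₀ + (k + 1)) (by omega) (hQK k hx)⟩ (hQO hx)

/-- The union of a sequence in which each set is a neighbourhood of its predecessor is Scott
open. -/
lemma isOpen_iUnion (h : IsScottExhaustion K) {n₀ : ℕ} {Q : ℕ → Set P}
    (hQK : ∀ k, Q k ⊆ K (n₀ + k)) (hQ : ∀ k, IsNhdIn (K (n₀ + (k + 1))) (Q k) (Q (k + 1))) :
    IsOpen[scott P univ] (⋃ k, Q k) := by
  refine (h.isOpen_iff _).2 fun n => ?_
  refine isOpen_iff_forall_mem_open (X := WithScott (K n)).2 fun x hx => ?_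
  obtain ⟨k, hk⟩ := mem_iUnion.1 hx
  obtain ⟨O, hO, hQO, hOQ⟩ := hQ (max k n)
  have hn : n ≤ n₀ + (max k n + 1) := by omega
  exact ⟨inclusion (h.mono _ _ hn) ⁻¹' O, fun y hy => mem_iUnion.2 ⟨_, hOQ hy⟩,
    hO.preimage (h.continuous_inclusion hn),
    hQO (h.monotone_of_isNhdIn hQK hQ (le_max_left k n) hk)⟩

/-- A box with compact sides inside a Scott open set `W` of `P × P` can be enlarged, within `W` and
the next member of the exhaustion, to a box whose sides are compact neighbourhoods of the old
sides. -/
lemma exists_compact_box (h : IsScottExhaustion K) {n m : ℕ} (hnm : n ≤ m)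
    [LocallyCompactSpace (WithScott (K m))]
    {W : Set (P × P)} (hW : IsOpen[scott (P × P) univ] W) {Q R : Set P}
    (hQ : IsCompactIn (K n) Q) (hR : IsCompactIn (K n) R) (hQR : Q ×ˢ R ⊆ W) :
    ∃ Q' R' : Set P, IsCompactIn (K m) Q' ∧ IsCompactIn (K m) R' ∧ Q' ×ˢ R' ⊆ W ∧
      IsNhdIn (K m) Q Q' ∧ IsNhdIn (K m) R R' := by
  obtain ⟨hQK, hQc⟩ := h.isCompactIn_mono hnm hQ
  obtain ⟨hRK, hRc⟩ := h.isCompactIn_mono hnm hR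
  obtain ⟨Q', R', hQ'c, hR'c, hQQ', hRR', hsub⟩ :=
    exists_compact_nhds_prod_subset (h.isOpen_prod_preimage hW m) hQc hRc fun p hp => hQR hp
  have hbox : ∀ {A : Set P} {B : Set (K m)},
      IsCompact (X := WithScott (K m)) B →
      (Subtype.val : K m → P) ⁻¹' A ⊆ interior (X := WithScott (K m)) B →
      IsCompactIn (K m) (Subtype.val '' B) ∧ IsNhdIn (K m) A (Subtype.val '' B) := by
    intro A B hB hAB
    have hval : (Subtype.val : K m → P) ⁻¹' (Subtype.val '' B) = B :=
      preimage_image_eq B Subtype.val_injective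
    refine ⟨⟨by rintro _ ⟨x, -, rfl⟩; exact x.2, hval.symm ▸ hB⟩,
      interior (X := WithScott (K m)) B, isOpen_interior (X := WithScott (K m)), hAB, ?_⟩
    rw [hval]
    exact interior_subset (X := WithScott (K m))
  obtain ⟨h1, h2⟩ := hbox hQ'c hQQ'
  obtain ⟨h3, h4⟩ := hbox hR'c hRR'
  refine ⟨_, _, h1, h3, ?_, h2, h4⟩
  rintro ⟨_, _⟩ ⟨⟨x, hx, rfl⟩, ⟨y, hy, rfl⟩⟩
  exact @hsub (x, y) ⟨hx, hy⟩

end IsScottExhaustion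

theorem IsLcOmegaPoset.scottProdEq (hP : IsLcOmegaPoset P) : ScottProdEq P := by
  obtain ⟨K, hK, hlc⟩ := hP
  refine TopologicalSpace.ext_iff.2 fun W => ⟨fun hW => ?_, isOpen_scott_prod⟩
  refine (@isOpen_prod_iff P P (scott P univ) (scott P univ) W).2 fun a b hab => ?_
  obtain ⟨n₀, ha, hb⟩ : ∃ n₀, a ∈ K n₀ ∧ b ∈ K n₀ := by
    obtain ⟨n, hn⟩ := mem_iUnion.1 (hK.iUnion_eq.superset (mem_univ a))
    obtain ⟨m, hm⟩ := mem_iUnion.1 (hK.iUnion_eq.superset (mem_univ b))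
    exact ⟨max n m, hK.mono _ _ (le_max_left _ _) hn, hK.mono _ _ (le_max_right _ _) hm⟩
  have hpt : ∀ x ∈ K n₀, IsCompactIn (K n₀) {x} := fun x hx =>
    ⟨singleton_subset_iff.2 hx,
      Finite.isCompact (X := WithScott (K n₀))
        ((finite_singleton x).preimage Subtype.val_injective.injOn)⟩
  let Good : ℕ → Set P × Set P → Prop := fun k p =>
    IsCompactIn (K (n₀ + k)) p.1 ∧ IsCompactIn (K (n₀ + k)) p.2 ∧ p.1 ×ˢ p.2 ⊆ W
  have step : ∀ k (p : {p // Good k p}), ∃ q : {q // Good (k + 1) q},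
      IsNhdIn (K (n₀ + (k + 1))) p.1.1 q.1.1 ∧ IsNhdIn (K (n₀ + (k + 1))) p.1.2 q.1.2 := by
    rintro k ⟨p, hp⟩
    obtain ⟨Q, R, hQ, hR, hQR, h1, h2⟩ :=
      hK.exists_compact_box (m := n₀ + (k + 1)) (by omega) hW hp.1 hp.2.1 hp.2.2
    exact ⟨⟨(Q, R), hQ, hR, hQR⟩, h1, h2⟩
  choose next hnext using step
  let f : ∀ k, {p // Good k p} := fun k =>
    Nat.rec ⟨({a}, {b}), hpt a ha, hpt b hb, by simpa using hab⟩ next k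
  have hf1 := fun k => (hnext k (f k)).1
  have hf2 := fun k => (hnext k (f k)).2
  have hU := hK.isOpen_iUnion (Q := fun k => (f k).1.1) (fun k => (f k).2.1.1) hf1
  have hV := hK.isOpen_iUnion (Q := fun k => (f k).1.2) (fun k => (f k).2.2.1.1) hf2
  refine ⟨_, _, hU, hV, mem_iUnion.2 ⟨0, rfl⟩, mem_iUnion.2 ⟨0, rfl⟩, ?_⟩
  rintro ⟨x, y⟩ ⟨hx, hy⟩
  obtain ⟨k, hk⟩ := mem_iUnion.1 hx
  obtain ⟨l, hl⟩ := mem_iUnion.1 hy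
  exact (f (max k l)).2.2.2
    ⟨hK.monotone_of_isNhdIn (Q := fun k => (f k).1.1) (fun k => (f k).2.1.1) hf1
        (le_max_left k l) hk,
      hK.monotone_of_isNhdIn (Q := fun k => (f k).1.2) (fun k => (f k).2.2.1.1) hf2
        (le_max_right k l) hl⟩

/-! ### Sufficient conditions for local compactness -/

lemma IsLocallyFiniteSpace.locallyCompactSpace {X : Type*} [TopologicalSpace X]
    (h : IsLocallyFiniteSpace X) : LocallyCompactSpace X := by
  refine ⟨fun x N hN => ?_⟩
  obtain ⟨U, hUN, hU, hxU⟩ := mem_nhds_iff.1 hN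
  obtain ⟨F, hF, -, hFo, hxF, hFU⟩ := h x U hU hxU
  exact ⟨nhdsKer F, hFo.mem_nhds hxF, hFU.trans hUN, IsCompact.nhdsKer_iff.2 hF.isCompact⟩

lemma IsSupercompact.isCompact {X : Type*} [TopologicalSpace X] {S : Set X}
    (h : IsSupercompact S) : IsCompact S := by
  refine isCompact_of_finite_subcover fun {ι} U hU hSU => ?_
  obtain ⟨_, ⟨i, rfl⟩, hi⟩ := h (range U) (by rintro _ ⟨i, rfl⟩; exact hU i) (by rwa [sUnion_range])
  exact ⟨{i}, by simpa using hi⟩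

lemma IsCSpace.locallyCompactSpace {X : Type*} [TopologicalSpace X] (h : IsCSpace X) :
    LocallyCompactSpace X := by
  refine ⟨fun x N hN => ?_⟩
  obtain ⟨U, hUN, hU, hxU⟩ := mem_nhds_iff.1 hN
  obtain ⟨S, hS, hxS, hSU⟩ := h x U hU hxU
  exact ⟨nhdsKer S, mem_interior_iff_mem_nhds.1 hxS, hSU.trans hUN,
    IsCompact.nhdsKer_iff.2 hS.isCompact⟩

theorem IsLfOmegaPoset.isLcOmegaPoset (h : IsLfOmegaPoset P) : IsLcOmegaPoset P :=
  let ⟨K, hK, hlf⟩ := h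
  ⟨K, hK, fun n => (hlf n).locallyCompactSpace⟩

lemma continuous_orderIso {A B : Type*} [PartialOrder A] [PartialOrder B] (e : A ≃o B) :
    Continuous (X := WithScott A) (Y := WithScott B) e := by
  refine continuous_def.2 fun U hU => ?_
  rw [isOpen_withScott_iff] at hU ⊢
  refine ⟨fun x y hxy hx => hU.1 (e.monotone hxy) hx, fun D hne hD s hs hsU => ?_⟩
  obtain ⟨_, ⟨d, hd, rfl⟩, hdU⟩ := hU.2 (hne.image e) (hD.mono_comp fun _ _ h => e.monotone h)
    (e.isLUB_image'.2 hs) hsU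
  exact ⟨d, hd, hdU⟩

/-- An order isomorphism is a homeomorphism for the Scott topologies. -/
def scottHomeomorph {A B : Type*} [PartialOrder A] [PartialOrder B] (e : A ≃o B) :
    WithScott A ≃ₜ WithScott B where
  toEquiv := e.toEquiv
  continuous_toFun := continuous_orderIso e
  continuous_invFun := continuous_orderIso e.symm

theorem isLcOmegaPoset_of_locallyCompactSpace [LocallyCompactSpace (WithScott P)] :
    IsLcOmegaPoset P := by
  let e : WithScott (univ : Set P) ≃ₜ WithScott P := scottHomeomorph OrderIso.Set.univ
  exact ⟨fun _ => univ, ⟨fun _ => .univ, fun _ _ _ => subset_rfl, iUnion_const _,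
    fun U => ⟨fun h _ => e.isOpen_preimage.2 h, fun h => e.isOpen_preimage.1 (h 0)⟩⟩,
    fun _ => e.isClosedEmbedding.locallyCompactSpace⟩

end Exhaustions

/-! ### Sets whose directed subsets are controlled by finitely many ideals -/

section Noetherian

variable {P : Type*} [PartialOrder P]

/-- Every directed subset of `X` has a greatest element or generates one of the lower sets in `𝓘`.
For `𝓘 = ∅` this says that all ideals of `X` are principal. The ideals are taken in the ambient
poset, so that the notion can be compared across different sets `X`. -/
def IsNoetherianModulo (X : Set P) (𝓘 : Set (Set P)) : Prop :=
  ∀ D ⊆ X, D.Nonempty → DirectedOn (· ≤ ·) D →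
    (∃ m, IsGreatest D m) ∨ (lowerClosure D : Set P) ∈ 𝓘

namespace IsNoetherianModulo

variable {X Y : Set P} {𝓘 𝓙 : Set (Set P)}

lemma union (hX : IsNoetherianModulo X 𝓘) (hY : IsNoetherianModulo Y 𝓙) :
    IsNoetherianModulo (X ∪ Y) (𝓘 ∪ 𝓙) := by
  -- A directed subset of `X ∪ Y` has a cofinal directed part in `X` or in `Y`.
  have key : ∀ {D D' : Set P} {𝓛 : Set (Set P)}, D' ⊆ D → IsCofinalFor D D' → 𝓛 ⊆ 𝓘 ∪ 𝓙 →
      ((∃ m, IsGreatest D' m) ∨ (lowerClosure D' : Set P) ∈ 𝓛) →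
      (∃ m, IsGreatest D m) ∨ (lowerClosure D : Set P) ∈ 𝓘 ∪ 𝓙 := by
    intro D D' 𝓛 hsub hcof h𝓛 h
    refine h.imp ?_ fun h' => h𝓛 ?_
    · rintro ⟨m, hm, hmax⟩
      refine ⟨m, hsub hm, fun d hd => ?_⟩
      obtain ⟨d', hd', hdd'⟩ := hcof hd
      exact hdd'.trans (hmax hd')
    · rwa [le_antisymm (lowerClosure_le.2 fun d hd => ?_) (lowerClosure_mono hsub)]
      exact mem_lowerClosure.2 (hcof hd)
  intro D hD hne hdir
  have hunion : D ∩ X ∪ D ∩ Y = D := by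
    rw [← inter_union_distrib_left, inter_eq_left.2 hD]
  rcases directedOn_union_iff.1 (hunion.symm ▸ hdir) with ⟨hd, hc⟩ | ⟨hd, hc⟩
  · have hcof : IsCofinalFor D (D ∩ X) := hc.union_right.mono_left hunion.ge
    exact key inter_subset_left hcof subset_union_left
      (hX _ inter_subset_right (hcof.nonempty hne) hd)
  · have hcof : IsCofinalFor D (D ∩ Y) := hc.union_left.mono_left hunion.ge
    exact key inter_subset_left hcof subset_union_right
      (hY _ inter_subset_right (hcof.nonempty hne) hd)

lemma biUnion {ι : Type*} {s : Set ι} (hs : s.Finite) {X : ι → Set P} {𝓘 : ι → Set (Set P)}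
    (h : ∀ i ∈ s, IsNoetherianModulo (X i) (𝓘 i)) :
    IsNoetherianModulo (⋃ i ∈ s, X i) (⋃ i ∈ s, 𝓘 i) := by
  induction s, hs using Set.Finite.induction_on with
  | empty => exact fun D hD hne => absurd (hne.mono hD) (by simp)
  | @insert i s _ _ ih =>
    rw [forall_mem_insert] at h
    simp only [biUnion_insert]
    exact h.1.union (ih h.2)

lemma mono (h : IsNoetherianModulo X 𝓘) (h𝓘 : 𝓘 ⊆ 𝓙) : IsNoetherianModulo X 𝓙 :=
  fun D hD hne hdir => (h D hD hne hdir).imp_right fun h => h𝓘 h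

lemma of_finite (hX : X.Finite) : IsNoetherianModulo X ∅ := by
  intro D hD hne hdir
  obtain ⟨m, hm, hmax⟩ := exists_forall_of_directedOn hne hdir (p := (· ≤ ·))
    (fun _ _ _ hab h => h.trans hab) (hX.subset hD) fun x hx => ⟨x, hx, le_rfl⟩
  exact Or.inl ⟨m, hm, hmax⟩

end IsNoetherianModulo

/-- The ideal generated by a nonempty directed set. -/
def idealOfDirectedOn {D : Set P} (hne : D.Nonempty) (hD : DirectedOn (· ≤ ·) D) :
    Order.Ideal P where
  toLowerSet := lowerClosure D
  nonempty' := hne.mono subset_lowerClosure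
  directed' := by
    rintro x ⟨a, ha, hxa⟩ y ⟨b, hb, hyb⟩
    obtain ⟨c, hc, hac, hbc⟩ := hD a ha b hb
    exact ⟨c, subset_lowerClosure hc, hxa.trans hac, hyb.trans hbc⟩

/-- A directed set has a greatest element or generates a non-principal ideal. -/
lemma exists_isGreatest_or_mem_nonprincipalIdeals {D : Set P} (hne : D.Nonempty)
    (hD : DirectedOn (· ≤ ·) D) :
    (∃ m, IsGreatest D m) ∨ idealOfDirectedOn hne hD ∈ nonprincipalIdeals P := by
  by_contra! hcon
  obtain ⟨h1, h2⟩ := hcon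
  simp only [nonprincipalIdeals, mem_ofPred_eq, not_forall, not_not] at h2
  obtain ⟨x, hx⟩ := h2
  have hmem : ∀ y, y ∈ lowerClosure D ↔ y ≤ x := fun y =>
    SetLike.ext_iff.1 hx y
  obtain ⟨d, hd, hxd⟩ := mem_lowerClosure.1 ((hmem x).2 le_rfl)
  exact h1 d ⟨hd, fun y hy => ((hmem y).1 (subset_lowerClosure hy)).trans hxd⟩

lemma isNoetherianModulo_of_nonprincipalIdeals_eq_empty {X : Set P}
    (hX : nonprincipalIdeals X = ∅) : IsNoetherianModulo X ∅ := by
  intro D hD hne hdir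
  have hD' : (Subtype.val : X → P) '' (Subtype.val ⁻¹' D) = D :=
    Subtype.image_preimage_coe X D ▸ inter_eq_right.2 hD
  rw [← hD'] at hne hdir
  rcases exists_isGreatest_or_mem_nonprincipalIdeals (P := X) hne.of_image
    ((directedOn_image (f := (Subtype.val : X → P))).1 hdir) with ⟨m, hm, hmax⟩ | h
  · exact Or.inl ⟨m, hm, fun d hd => hmax (show (⟨d, hD hd⟩ : X) ∈ _ from hd)⟩
  · exact absurd h (hX ▸ notMem_empty _)

lemma isNoetherianModulo_range {c : ℕ → P} (hc : StrictMono c) :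
    IsNoetherianModulo (range c) {(lowerClosure (range c) : Set P)} := by
  intro D hD hne hdir
  by_cases hb : BddAbove (c ⁻¹' D)
  · have hne' : (c ⁻¹' D).Nonempty := by
      obtain ⟨d, hd⟩ := hne
      obtain ⟨n, rfl⟩ := hD hd
      exact ⟨n, hd⟩
    refine Or.inl ⟨c (sSup (c ⁻¹' D)), Nat.sSup_mem hne' hb, fun d hd => ?_⟩
    obtain ⟨n, rfl⟩ := hD hd
    exact hc.monotone (le_csSup hb hd)
  · refine Or.inr (congrArg _ (le_antisymm (lowerClosure_mono hD) (lowerClosure_le.2 ?_)))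
    rintro _ ⟨n, rfl⟩
    obtain ⟨m, hm, hnm⟩ := not_bddAbove_iff.1 hb n
    exact mem_lowerClosure.2 ⟨c m, hm, hc.monotone hnm.le⟩

/-- If the directed subsets of `P` without greatest element generate only finitely many ideals,
then a point `x` of a Scott open set `U` together with one point of `U` from each of these ideals
(if it meets `U`) generates a Scott open set. -/
lemma IsNoetherianModulo.isLocallyFiniteSpace {𝓘 : Set (Set P)}
    (h : IsNoetherianModulo (univ : Set P) 𝓘) (h𝓘 : 𝓘.Finite) :
    IsLocallyFiniteSpace (WithScott P) := by
  intro x U hU hx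
  have hch : ∀ I : Set P, ∃ y ∈ (U : Set P), (I ∩ (U : Set P)).Nonempty → y ∈ I := by
    intro I
    by_cases hI : (I ∩ (U : Set P)).Nonempty
    · exact ⟨hI.some, hI.some_mem.2, fun _ => hI.some_mem.1⟩
    · exact ⟨x, hx, fun h => absurd h hI⟩
  choose f hfU hfI using hch
  have hU' := isOpen_withScott_iff.1 hU
  let F : Set (WithScott P) := insert x (f '' 𝓘)
  have hFU : nhdsKer F ⊆ U := by
    refine hU.nhdsKer_subset.2 (insert_subset hx ?_)
    rintro _ ⟨I, -, rfl⟩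
    exact hfU I
  refine ⟨F, (h𝓘.image f).insert x, insert_nonempty _ _, ?_,
    subset_nhdsKer (mem_insert _ _), hFU⟩
  refine isOpen_withScott_iff.2 ⟨fun y z hyz hy => ?_, fun D hne hD s hs hsF => ?_⟩
  · obtain ⟨w, hw, hwy⟩ := mem_nhdsKer_withScott_iff.1 hy
    exact mem_nhdsKer_withScott_iff.2 ⟨w, hw, le_trans (α := P) hwy hyz⟩
  · rcases h D (subset_univ _) hne hD with ⟨m, hm⟩ | hI
    · exact ⟨m, hm.1, hm.isLUB.unique hs ▸ hsF⟩
    · obtain ⟨d, hd, hdU⟩ := hU'.2 hne hD hs (hFU hsF)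
      obtain ⟨e, he, hfe⟩ := mem_lowerClosure.1 (hfI _ ⟨d, subset_lowerClosure hd, hdU⟩)
      exact ⟨e, he, mem_nhdsKer_withScott_iff.2
        ⟨_, mem_insert_of_mem _ (mem_image_of_mem f hI), hfe⟩⟩

lemma IsNoetherianModulo.univ_subtype {X : Set P} {𝓘 : Set (Set P)} (h : IsNoetherianModulo X 𝓘) :
    IsNoetherianModulo (univ : Set X) ((Subtype.val ⁻¹' ·) '' 𝓘) := by
  intro D _ hne hD
  rcases h (Subtype.val '' D) (by rintro _ ⟨x, -, rfl⟩; exact x.2) (hne.image _)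
    (hD.mono_comp fun _ _ h => h) with ⟨_, ⟨m, hm, rfl⟩, hmax⟩ | hI
  · exact Or.inl ⟨m, hm, fun d hd => hmax (mem_image_of_mem _ hd)⟩
  · refine Or.inr ⟨_, hI, ?_⟩
    ext x
    simp only [mem_preimage, SetLike.mem_coe, mem_lowerClosure, exists_mem_image]
    rfl

end Noetherian

/-! ### `c`-posets -/

section CPosets

variable {P : Type*} [PartialOrder P]

lemma isLUB_lowerClosure_iff {D : Set P} {s : P} :
    IsLUB (lowerClosure D : Set P) s ↔ IsLUB D s := by
  simp [IsLUB]

theorem IsCPoset.isLfOmegaPoset (h : IsCPoset P) : IsLfOmegaPoset P := by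
  classical
  obtain ⟨hcount, c, hc, T, hT, hTn⟩ := h
  have : Countable (nonprincipalIdeals P) := hcount.to_subtype
  obtain ⟨e, he⟩ := exists_injective_nat (nonprincipalIdeals P)
  have hcI : ∀ I : nonprincipalIdeals P,
      ((I : Order.Ideal P) : Set P) = lowerClosure (range (c I)) := fun I => by
    rw [(hc I).2]
    ext x
    simp [mem_lowerClosure]
  -- A chain without supremum must enter the exhaustion pointwise: a member containing the whole
  -- chain could contain a least upper bound of it that is not a supremum in `P`.
  let G : nonprincipalIdeals P → ℕ → Set P := fun I n =>
    if ∃ s, IsLUB (range (c I)) s then rangeWithSup (c I) else c I '' Iic n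
  let 𝓖 : nonprincipalIdeals P → Set (Set P) := fun I =>
    {A | A = lowerClosure (range (c I)) ∧ ∃ s, IsLUB (range (c I)) s}
  have hG : ∀ I n, IsNoetherianModulo (G I n) (𝓖 I) := by
    intro I n
    by_cases hs : ∃ s, IsLUB (range (c I)) s
    · simp only [G, if_pos hs]
      refine ((isNoetherianModulo_range (hc I).1).union
        (.of_finite (Subsingleton.finite fun s hs t ht => IsLUB.unique hs ht))).mono ?_
      rintro A (rfl | hA)
      exacts [⟨rfl, hs⟩, absurd hA (notMem_empty A)]
    · simp only [G, if_neg hs]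
      exact (IsNoetherianModulo.of_finite ((finite_Iic n).image _)).mono (empty_subset _)
  have hGmono : ∀ I n m, n ≤ m → G I n ⊆ G I m := by
    intro I n m hnm
    by_cases hs : ∃ s, IsLUB (range (c I)) s
    · simp only [G, if_pos hs, subset_rfl]
    · simp only [G, if_neg hs]
      exact image_mono (Iic_subset_Iic.2 hnm)
  have hGsup : ∀ I n s, IsLUB (range (c I)) s → G I n = rangeWithSup (c I) := fun I n s hs =>
    if_pos ⟨s, hs⟩
  let K : ℕ → Set P := fun n => (⋃ k ∈ Iic n, T k) ∪ ⋃ I ∈ {I | e I ≤ n}, G I n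
  have hGK : ∀ {I n}, e I ≤ n → G I n ⊆ K n := fun {I n} hI =>
    (subset_biUnion_of_mem (u := fun I => G I n) hI).trans subset_union_right
  have hfin : ∀ n, {I | e I ≤ n}.Finite := fun n => (finite_Iic n).preimage he.injOn
  let 𝓘 : ℕ → Set (Set P) := fun n => ⋃ I ∈ {I | e I ≤ n}, 𝓖 I
  have hK : ∀ n, IsNoetherianModulo (K n) (𝓘 n) := by
    intro n
    refine ((IsNoetherianModulo.biUnion (𝓘 := fun _ => ∅) (finite_Iic n) fun k _ =>
      isNoetherianModulo_of_nonprincipalIdeals_eq_empty (hTn k)).union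
      (IsNoetherianModulo.biUnion (hfin n) fun I _ => hG I n)).mono ?_
    simp [𝓘]
  have h𝓘 : ∀ n, (𝓘 n).Finite := fun n =>
    (hfin n).biUnion fun I _ => (finite_singleton _).subset fun A hA => hA.1
  -- Every directed subset of `K n` has a supremum in `P`, which lies in `K n`.
  have hsup : ∀ n, ∀ D ⊆ K n, D.Nonempty → DirectedOn (· ≤ ·) D → ∃ s ∈ K n, IsLUB D s := by
    intro n D hD hne hdir
    rcases hK n D hD hne hdir with ⟨m, hm⟩ | hI
    · exact ⟨m, hD hm.1, hm.isLUB⟩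
    · simp only [𝓘, mem_iUnion] at hI
      obtain ⟨I, hIn, hID, s, hs⟩ := hI
      refine ⟨s, hGK hIn (hGsup I n s hs ▸ Or.inr hs), ?_⟩
      rwa [← isLUB_lowerClosure_iff, hID, isLUB_lowerClosure_iff]
  have hmono : ∀ n m, n ≤ m → K n ⊆ K m := by
    intro n m hnm
    refine union_subset_union (biUnion_subset_biUnion_left (Iic_subset_Iic.2 hnm))
      (iUnion₂_subset fun I hI => (hGmono I n m hnm).trans ?_)
    exact subset_biUnion_of_mem (u := fun I => G I m) (show e I ≤ m from le_trans hI hnm)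
  have hcover : ∀ x, ∃ n, x ∈ K n := by
    intro x
    by_cases hx : x ∈ ⋃ I, rangeWithSup (c I)
    · obtain ⟨I, hxI⟩ := mem_iUnion.1 hx
      by_cases hs : ∃ s, IsLUB (range (c I)) s
      · obtain ⟨s, hs⟩ := hs
        exact ⟨e I, hGK le_rfl (hGsup I _ s hs ▸ hxI)⟩
      · rcases hxI with ⟨m, rfl⟩ | hxs
        · refine ⟨max (e I) m, hGK (I := I) (le_max_left _ _) ?_⟩
          simp only [G, if_neg hs]
          exact mem_image_of_mem _ (mem_Iic.2 (le_max_right _ _))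
        · exact absurd ⟨x, hxs⟩ hs
    · rw [← mem_compl_iff, hT] at hx
      obtain ⟨k, hk⟩ := mem_iUnion.1 hx
      exact ⟨k, Or.inl (mem_biUnion (mem_Iic.2 le_rfl) hk)⟩
  refine ⟨K, ⟨fun n D hD hne hdir a ha => ?_, hmono, eq_univ_of_forall fun x =>
    mem_iUnion.2 (hcover x), fun U => ⟨fun hU n => ?_, fun hU => ?_⟩⟩,
    fun n => (hK n).univ_subtype.isLocallyFiniteSpace ((h𝓘 n).image _)⟩
  · obtain ⟨s, hsK, hs⟩ := hsup n D hD hne hdir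
    exact ha.unique hs ▸ hsK
  · rw [isOpen_scott_iff] at hU ⊢
    refine ⟨fun x y hxy hx => hU.1 hxy hx, fun D hne hD s hs hsU => ?_⟩
    obtain ⟨t, htK, ht⟩ := hsup n (Subtype.val '' D) (by rintro _ ⟨x, -, rfl⟩; exact x.2)
      (hne.image _) (hD.mono_comp fun _ _ h => h)
    have hts : (⟨t, htK⟩ : K n) = s := by
      refine IsLUB.unique ⟨fun d hd => ht.1 (mem_image_of_mem _ hd), fun u hu => ht.2 ?_⟩ hs
      rintro _ ⟨d, hd, rfl⟩
      exact hu hd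
    obtain ⟨_, ⟨d, hd, rfl⟩, hdU⟩ := hU.2 (hne.image _) (hD.mono_comp fun _ _ h => h) ht
      (show t ∈ U by rw [← hts] at hsU; exact hsU)
    exact ⟨d, hd, hdU⟩
  · simp only [isOpen_scott_iff] at hU ⊢
    refine ⟨fun x y hxy hx => ?_, fun D hne hD s hs hsU => ?_⟩
    · obtain ⟨n, hn⟩ := hcover x
      obtain ⟨m, hm⟩ := hcover y
      exact @(hU (max n m)).1 ⟨x, hmono _ _ (le_max_left _ _) hn⟩
        ⟨y, hmono _ _ (le_max_right _ _) hm⟩ hxy hx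
    · rcases exists_isGreatest_or_mem_nonprincipalIdeals hne hD with ⟨m, hm⟩ | hI
      · exact ⟨m, hm.1, hm.isLUB.unique hs ▸ hsU⟩
      -- The chain generating `↓D` has the same supremum as `D` and lies in some `K n`.
      · obtain ⟨I, hID⟩ : ∃ I : nonprincipalIdeals P,
            (I : Order.Ideal P) = idealOfDirectedOn hne hD :=
          ⟨⟨_, hI⟩, rfl⟩
        have hDc : (lowerClosure D : Set P) = lowerClosure (range (c I)) := by
          rw [← hcI, hID]
          rfl
        have hcs : IsLUB (range (c I)) s := by
          rwa [← isLUB_lowerClosure_iff, ← hDc, isLUB_lowerClosure_iff]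
        have hGe : rangeWithSup (c I) ⊆ K (e I) := hGsup I _ s hcs ▸ hGK le_rfl
        let c' : ℕ → K (e I) := fun m => ⟨c I m, hGe (Or.inl (mem_range_self m))⟩
        have hc' : Monotone c' := fun m n hmn => (hc I).1.monotone hmn
        have hcs' : IsLUB (range c') ⟨s, hGe (Or.inr hcs)⟩ := by
          refine ⟨?_, fun u hu => hcs.2 ?_⟩
          · rintro _ ⟨m, rfl⟩
            exact hcs.1 (mem_range_self m)
          · rintro _ ⟨m, rfl⟩
            exact hu (mem_range_self m)
        obtain ⟨_, ⟨m, rfl⟩, hmU⟩ := (hU (e I)).2 (range_nonempty c')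
          (directedOn_range.2 hc'.directed_le) hcs' hsU
        have hmD : c I m ∈ (lowerClosure D : Set P) := hDc ▸ subset_lowerClosure (mem_range_self m)
        obtain ⟨d, hd, hmd⟩ := mem_lowerClosure.1 hmD
        obtain ⟨n, hn⟩ := hcover d
        exact ⟨d, hd, @(hU (max (e I) n)).1 ⟨c I m, hmono _ _ (le_max_left _ _) (c' m).2⟩
          ⟨d, hmono _ _ (le_max_right _ _) hn⟩ hmd hmU⟩

/-- A countable ideal that is not principal is generated by a strictly increasing sequence. -/
lemma exists_strictMono_of_mem_nonprincipalIdeals [Countable P] {I : Order.Ideal P}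
    (hI : I ∈ nonprincipalIdeals P) :
    ∃ c : ℕ → P, StrictMono c ∧ (I : Set P) = {x | ∃ m, x ≤ c m} := by
  have : Nonempty I := I.nonempty.to_subtype
  obtain ⟨a, ha⟩ := exists_surjective_nat I
  have step : ∀ x y : I, ∃ z : I, x < z ∧ y ≤ z := by
    intro x y
    obtain ⟨z, hz, hxz, hyz⟩ := I.directed x x.2 y y.2
    obtain ⟨w, hw, hwz⟩ : ∃ w ∈ I, ¬ w ≤ z := by
      by_contra! hcon
      exact hI z (le_antisymm (fun w hw => hcon w hw) (Order.Ideal.principal_le_iff.2 hz))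
    obtain ⟨v, hv, hzv, hwv⟩ := I.directed z hz w hw
    exact ⟨⟨v, hv⟩, lt_of_le_not_ge (hxz.trans hzv) fun hvx => hwz (hwv.trans (le_trans hvx hxz)),
      hyz.trans hzv⟩
  choose next hlt hle using step
  let c : ℕ → I := fun n => Nat.rec (a 0) (fun k x => next x (a k)) n
  have hc : ∀ n, c n < c (n + 1) := fun n => hlt (c n) (a n)
  refine ⟨fun n => (c n).1, strictMono_nat_of_lt_succ hc, ?_⟩
  ext x
  constructor
  · intro hx
    obtain ⟨n, hn⟩ := ha ⟨x, hx⟩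
    refine ⟨n + 1, ?_⟩
    have hle' : (a n : P) ≤ c (n + 1) := hle (c n) (a n)
    rwa [hn] at hle'
  · rintro ⟨m, hm⟩
    exact I.lower hm (c m).2

theorem isCPoset_of_countable_ideal [Countable (Order.Ideal P)] : IsCPoset P := by
  have : Countable P := Function.Injective.countable (f := Order.Ideal.principal (P := P))
    fun x y hxy => le_antisymm (Order.Ideal.principal_le_iff.1 hxy.le)
      (Order.Ideal.principal_le_iff.1 hxy.ge)
  choose c hc using fun I : nonprincipalIdeals P => exists_strictMono_of_mem_nonprincipalIdeals I.2
  refine ⟨to_countable _, c, hc, ?_⟩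
  obtain ⟨e, he⟩ := exists_injective_nat P
  refine ⟨fun n => {x | x ∉ ⋃ I, rangeWithSup (c I) ∧ e x = n}, by ext; simp, fun n => ?_⟩
  -- The sets `T n` have at most one element.
  refine eq_empty_of_forall_notMem fun I hI => ?_
  obtain ⟨x, hx⟩ := I.nonempty
  refine hI x (le_antisymm (fun y _ => ?_) (Order.Ideal.principal_le_iff.2 hx))
  exact (Subtype.ext (he (y.2.2.trans x.2.2.symm)) : y = x).le

end CPosets

end DomainTheory

theorem theorem5p14 {P : Type*} [PartialOrder P] :
    -- the sobriety statement
    ((Countable (Order.Ideal P) ∨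
        (DomainTheory.IsCPoset P ∨ DomainTheory.IsCSpace (Topology.WithScott P)) ∨
        DomainTheory.IsLfOmegaPoset P ∨
        DomainTheory.IsLcOmegaPoset P ∨
        DomainTheory.ScottProdEq P) →
      (CompactSpace (Topology.WithLawson P) ∨
        DomainTheory.IsUpperSemicompact (Topology.WithLawson P) ∨
        (DomainTheory.IsWellFiltered (Topology.WithScott P) ∧
          DomainTheory.IsCoherent (Topology.WithScott P)) ∨
        DomainTheory.HasPropertyR (Topology.WithScott P)) →
      DomainTheory.IsSober (Topology.WithScott P)) ∧
    -- the implications between the conditions of the first group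
    (Countable (Order.Ideal P) → DomainTheory.IsCPoset P) ∧
    (DomainTheory.IsCPoset P → DomainTheory.IsLfOmegaPoset P) ∧
    (DomainTheory.IsLfOmegaPoset P → DomainTheory.IsLcOmegaPoset P) ∧
    (DomainTheory.IsCSpace (Topology.WithScott P) → DomainTheory.IsLcOmegaPoset P) ∧
    (DomainTheory.IsLcOmegaPoset P → DomainTheory.ScottProdEq P) ∧
    -- the implications between the conditions of the second group
    (CompactSpace (Topology.WithLawson P) →
      DomainTheory.IsUpperSemicompact (Topology.WithLawson P)) ∧
    (DomainTheory.IsUpperSemicompact (Topology.WithLawson P) →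
      DomainTheory.HasPropertyR (Topology.WithScott P)) ∧
    (DomainTheory.IsWellFiltered (Topology.WithScott P) ∧
        DomainTheory.IsCoherent (Topology.WithScott P) →
      DomainTheory.HasPropertyR (Topology.WithScott P)) := by
  have h1 : Countable (Order.Ideal P) → DomainTheory.IsCPoset P :=
    fun _ => DomainTheory.isCPoset_of_countable_ideal
  have h2 : DomainTheory.IsCPoset P → DomainTheory.IsLfOmegaPoset P :=
    DomainTheory.IsCPoset.isLfOmegaPoset
  have h3 : DomainTheory.IsLfOmegaPoset P → DomainTheory.IsLcOmegaPoset P :=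
    DomainTheory.IsLfOmegaPoset.isLcOmegaPoset
  have h4 : DomainTheory.IsCSpace (Topology.WithScott P) → DomainTheory.IsLcOmegaPoset P :=
    fun h => have := h.locallyCompactSpace; DomainTheory.isLcOmegaPoset_of_locallyCompactSpace
  have h5 : DomainTheory.IsLcOmegaPoset P → DomainTheory.ScottProdEq P :=
    DomainTheory.IsLcOmegaPoset.scottProdEq
  have h6 : CompactSpace (Topology.WithLawson P) →
      DomainTheory.IsUpperSemicompact (Topology.WithLawson P) :=
    fun _ => DomainTheory.isUpperSemicompact_of_compactSpace
  have h7 : DomainTheory.IsUpperSemicompact (Topology.WithLawson P) →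
      DomainTheory.HasPropertyR (Topology.WithScott P) :=
    DomainTheory.hasPropertyR_of_isUpperSemicompact
  have h8 : DomainTheory.IsWellFiltered (Topology.WithScott P) ∧
      DomainTheory.IsCoherent (Topology.WithScott P) →
      DomainTheory.HasPropertyR (Topology.WithScott P) :=
    fun h => DomainTheory.hasPropertyR_of_isWellFiltered_of_isCoherent h.1 h.2
  refine ⟨fun hv hd => DomainTheory.isSober_of_scottProdEq_of_hasPropertyR ?_ ?_,
    h1, h2, h3, h4, h5, h6, h7, h8⟩
  · rcases hv with h | (h | h) | h | h | h
    exacts [h5 (h3 (h2 (h1 h))), h5 (h3 (h2 h)), h5 (h4 h), h5 (h3 h), h5 h, h]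
  · rcases hd with h | h | h | h
    exacts [h7 (h6 h), h7 h, h8 h, h]
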